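/- **Setting.** Let $\kappa$ be a singular cardinal of cofinality $\omega$ with $\kappa=\beth_\kappa$. Let $\tau$ be a countable relational vocabulary (no constant or function symbols) whose relation symbols may have infinite arity, with all arities bounded by a single cardinal $\rho<\kappa$. Models of $\tau$ are non-empty. **Logics and the Chu order.** A logic is a triple $(L,\models,S)$ of a class $L$ of sentences, a class $S$ of models and a relation $\models\ \subseteq S\times L$. Write $(L,\models,S)\le(L',\models',S')$ if there is a Chu transform with dense range between them, i.e. maps $f:L\to L'$ and $g:S'\to S$ such that $s'\models' f(\varphi)\iff g(s')\models\varphi$ for all $s'\in S'$, $\varphi\in L$ (adjointness), and every $\varphi\in L$ that has a model in $S$ has a model of the form $g(s')$ with $s'\in S'$ (density). **Shelah's logic.** For a cardinal $\theta$ and an ordinal $\beta$, the game $BG^\beta_\theta(\mathfrak A,\mathfrak B)$ is played as follows. Player I first picks $\theta_0\le\theta$. In round $n$, Player I picks an ordinal $\beta_n$ with $\beta_0<\beta$ and $\beta_{n}<\beta_{n-1}$ for $n\geq 1$, and a set $X_n$ with $|X_n|\le\theta_0$, where $X_n\subseteq A$ for $n$ even and $X_n\subseteq B$ for $n$ odd.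 Player II answers with a function $h_n:X_n\to\omega$ and a partial isomorphism $g_n$ from $\mathfrak A$ to $\mathfrak B$ extending $g_{n-1}$, such that for all $i\le n$ the set $h_i^{-1}(n-i)$ is contained in $\mathrm{dom}(g_n)$ if $i$ is even and in $\mathrm{ran}(g_n)$ if $i$ is odd. The game ends when the ordinal $0$ is reached, and Player II wins iff she can play to the end. Let $\mathfrak A\sim_{\beta,\theta}\mathfrak B$ iff Player II has a winning strategy, and let $\equiv^\beta_\theta$ be the equivalence relation generated by $\sim_{\beta,\theta}$. A sentence of $L^1_\kappa$ is a class $K$ of models of $\tau$ that is, for some $\theta<\kappa$ and some $\beta<\theta^+$, a union of $\equiv^\beta_\theta$-classes; $\mathfrak A\models_{L^1_\kappa}K$ means $\mathfrak A\in K$. Let $\mathcal K$ be the class of all models of $\tau$. **Chain logic.** A weak chain model $(C_n)_{n<\omega}$ of $\tau$ consists of a model of $\tau$ and subsets $C_0\subseteq C_1\subseteq\cdots$ of its universe whose union is the whole universe; the model is denoted $\bigcup_n C_n$. Let $\mathcal K^c$ be the class of all weak chain models of $\tau$. Sentences of $L^{c,*}_{\kappa,\kappa}$ are the $L_{\kappa,\kappa}$-sentences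 of $\tau$ (with equality, negation, conjunctions and disjunctions of length $<\kappa$, and strings of $<\kappa$ existential quantifiers), and $\models^c$ is defined by the usual induction on formulas, except that $(C_n)_{n<\omega}\models^c\exists\bar x\,\varphi(\bar x)$ iff there are $n<\omega$ and a tuple $\bar a$ of elements of $C_n$ with $(C_n)_{n<\omega}\models^c\varphi[\bar a]$. **Theorem 4.6.** With these assumptions, $$(L^1_\kappa,\models_{L^1_\kappa},\mathcal K)\ \le\ (L^{c,*}_{\kappa,\kappa},\models^c,\mathcal K^c).$$ Moreover, this is witnessed by a Chu transform $(f,g)$ with dense range such that $g((C_n)_{n<\omega})=\bigcup_n C_n$ for every weak chain model, and such that for every $L^1_\kappa$-sentence $K$ the sentence $f(K)$ defines the class $\mathcal C(K)$ of all weak chain representations of models in $K$, i.e. $(C_n)_{n<\omega}\models^c f(K)\iff\bigcup_n C_n\in K$. -/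

import Mathlib

universe u

namespace ChainLogic

/-- A relational vocabulary. The arity of a relation symbol is an arbitrary, possibly infinite,
cardinal; `Arity R` is the set of argument places of `R`. -/
structure Vocabulary : Type (u + 1) where
  Rel : Type u
  Arity : Rel → Type u

/-- Models of a vocabulary: non-empty sets with an interpretation of the relation symbols. -/
structure Model (τ : Vocabulary.{u}) : Type (u + 1) where
  carrier : Type u
  nonempty : Nonempty carrier
  rel : ∀ R : τ.Rel, (τ.Arity R → carrier) → Prop

instance (τ : Vocabulary.{u}) : CoeSort (Model τ) (Type u) := ⟨Model.carrier⟩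

/-! ### Abstract logics and Chu transforms -/

/-- An abstract logic: sentences, models and a satisfaction relation. -/
structure Logic : Type (u + 2) where
  Sentence : Type (u + 1)
  Mod : Type (u + 1)
  Sat : Mod → Sentence → Prop

/-- Chu transforms between logics: a pair of maps satisfying the adjointness condition. -/
structure ChuTransform (𝔏 𝔏' : Logic.{u}) : Type (u + 1) where
  onSentences : 𝔏.Sentence → 𝔏'.Sentence
  onModels : 𝔏'.Mod → 𝔏.Mod
  adjoint : ∀ (s' : 𝔏'.Mod) (φ : 𝔏.Sentence),
    𝔏'.Sat s' (onSentences φ) ↔ 𝔏.Sat (onModels s') φ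

/-- Density of the range of the map on models: every sentence which has a model has a model
in that range. -/
def ChuTransform.IsDense {𝔏 𝔏' : Logic.{u}} (T : ChuTransform 𝔏 𝔏') : Prop :=
  ∀ φ : 𝔏.Sentence, (∃ s, 𝔏.Sat s φ) → ∃ s', 𝔏.Sat (T.onModels s') φ

/-- The Chu order `𝔏 ≤ 𝔏'` on logics. -/
def Logic.ChuLE (𝔏 𝔏' : Logic.{u}) : Prop :=
  ∃ T : ChuTransform 𝔏 𝔏', T.IsDense

/-! ### The borrowing game and Shelah's logic -/

section Game

variable {τ : Vocabulary.{u}}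

/-- The domain of a partial injection. -/
def domain {A B : Type u} (g : A ≃. B) : Set A := {a | ∃ b, b ∈ g a}

/-- A partial injection `g` from `M` to `N` is a partial isomorphism if it preserves and reflects
all relations, on all tuples from its domain. -/
def IsPartialIso {M N : Model τ} (g : M ≃. N) : Prop :=
  ∀ (R : τ.Rel) (x : τ.Arity R → M) (y : τ.Arity R → N),
    (∀ i, y i ∈ g (x i)) → (M.rel R x ↔ N.rel R y)

/-- `PlayerTwoWins θ₀ M N β P Q g`: Player II has a winning strategy in the borrowing game from
the position in which

* it is the turn of Player I, who has to play a subset of `M` of size at most `θ₀` and an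
  ordinal below `β`;
* `g` is the partial isomorphism from `M` to `N` built so far;
* `P k` is the set of those elements of `M`, and `Q k` the set of those elements of `N`, which by
  the earlier functions `h` have to enter the domain, respectively the range, of the partial
  isomorphism played by Player II `k` rounds later (`k = 0` being the round about to be played).

If Player I plays the ordinal `γ < β` and the set `X`, then Player II answers by the restriction
of `h γ X` to `X` and by `g' γ X`. In the following round the two models change roles. A position
in which `β = 0` ends the game, and is won by Player II. -/
inductive PlayerTwoWins (θ₀ : Cardinal.{u}) :
    (M N : Model τ) → Ordinal.{u} → (ℕ → Set M) → (ℕ → Set N) → (M ≃. N) → Prop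
  | intro {M N : Model τ} {β : Ordinal.{u}} {P : ℕ → Set M} {Q : ℕ → Set N} {g : M ≃. N}
      (h : Ordinal.{u} → Set M → M → ℕ)
      (g' : Ordinal.{u} → Set M → (M ≃. N))
      (extends_prev : ∀ γ < β, ∀ X : Set M, Cardinal.mk X ≤ θ₀ → g ≤ g' γ X)
      (partial_iso : ∀ γ < β, ∀ X : Set M, Cardinal.mk X ≤ θ₀ → IsPartialIso (g' γ X))
      (repays_new : ∀ γ < β, ∀ X : Set M, Cardinal.mk X ≤ θ₀ →
        {x ∈ X | h γ X x = 0} ⊆ domain (g' γ X))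
      (repays_left : ∀ γ < β, ∀ X : Set M, Cardinal.mk X ≤ θ₀ → P 0 ⊆ domain (g' γ X))
      (repays_right : ∀ γ < β, ∀ X : Set M, Cardinal.mk X ≤ θ₀ → Q 0 ⊆ domain (g' γ X).symm)
      (continues : ∀ γ < β, ∀ X : Set M, Cardinal.mk X ≤ θ₀ →
        PlayerTwoWins θ₀ N M γ
          (fun k => Q (k + 1))
          (fun k => P (k + 1) ∪ {x ∈ X | h γ X x = k + 1})
          (g' γ X).symm) :
      PlayerTwoWins θ₀ M N β P Q g

/-- `M ∼_{β,θ} N`: Player II has a winning strategy in the borrowing game of length `β` and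
width `θ`. Player I starts by choosing `θ₀ ≤ θ`; there is nothing to repay yet, and the partial
isomorphism is empty. -/
def BorrowingSim (β : Ordinal.{u}) (θ : Cardinal.{u}) (M N : Model τ) : Prop :=
  ∀ θ₀ ≤ θ, PlayerTwoWins θ₀ M N β (fun _ => ∅) (fun _ => ∅) ⊥

variable (τ) in
/-- `≡^β_θ`: the equivalence relation generated by `∼_{β,θ}`. -/
def borrowingSetoid (β : Ordinal.{u}) (θ : Cardinal.{u}) : Setoid (Model τ) :=
  Relation.EqvGen.setoid (BorrowingSim β θ)

end Game

/-- `K` is a sentence of Shelah's logic `L^1_κ`: for some `θ < κ` and some `β < θ⁺`, it is a union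
of equivalence classes of `≡^β_θ`. -/
def IsShelahSentence {τ : Vocabulary.{u}} (κ : Cardinal.{u}) (K : Set (Model τ)) : Prop :=
  ∃ θ < κ, ∃ β < (Order.succ θ).ord,
    ∃ E : Set (Set (Model τ)), E ⊆ (borrowingSetoid τ β θ).classes ∧ K = ⋃₀ E

/-- Shelah's logic `L^1_κ` on the class of all models of `τ`. -/
def shelahLogic (τ : Vocabulary.{u}) (κ : Cardinal.{u}) : Logic.{u} where
  Sentence := {K : Set (Model τ) // IsShelahSentence κ K}
  Mod := Model τ
  Sat M K := M ∈ K.1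

/-! ### Infinitary formulas and chain logic -/

/-- The formulas of `L_{μ,ν}` with free variables in `X`: conjunctions and disjunctions of fewer
than `μ` formulas, existential quantification over fewer than `ν` variables at once. -/
inductive Formula (τ : Vocabulary.{u}) (μ ν : Cardinal.{u}) : Type u → Type (u + 1)
  | equal {X : Type u} (x y : X) : Formula τ μ ν X
  | rel {X : Type u} (R : τ.Rel) (x : τ.Arity R → X) : Formula τ μ ν X
  | neg {X : Type u} (φ : Formula τ μ ν X) : Formula τ μ ν X
  | conj {X : Type u} (I : Type u) (hI : Cardinal.mk I < μ) (φ : I → Formula τ μ ν X) :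
      Formula τ μ ν X
  | disj {X : Type u} (I : Type u) (hI : Cardinal.mk I < μ) (φ : I → Formula τ μ ν X) :
      Formula τ μ ν X
  | ex {X : Type u} (Y : Type u) (hY : Cardinal.mk Y < ν) (φ : Formula τ μ ν (X ⊕ Y)) :
      Formula τ μ ν X

/-- Weak chain models: a model with an increasing `ω`-sequence of subsets whose union is the
whole universe. -/
structure WeakChainModel (τ : Vocabulary.{u}) : Type (u + 1) where
  model : Model τ
  chain : ℕ → Set model
  chain_subset_succ : ∀ n, chain n ⊆ chain (n + 1)
  iUnion_chain : ⋃ n, chain n = Set.univ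

/-- The truth definition `⊨^c` in chain models: an existential quantifier over a string of
variables asks for a witness contained in a single member of the chain. -/
def Formula.Holds {τ : Vocabulary.{u}} {μ ν : Cardinal.{u}} (C : WeakChainModel τ) :
    {X : Type u} → Formula τ μ ν X → (X → C.model) → Prop
  | _, .equal x y, v => v x = v y
  | _, .rel R x, v => C.model.rel R (fun i => v (x i))
  | _, .neg φ, v => ¬ φ.Holds C v
  | _, .conj _ _ φ, v => ∀ i, (φ i).Holds C v
  | _, .disj _ _ φ, v => ∃ i, (φ i).Holds C v
  | _, .ex Y _ φ, v =>
      ∃ n : ℕ, ∃ b : Y → C.model, (∀ y, b y ∈ C.chain n) ∧ φ.Holds C (Sum.elim v b)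

/-- The weak chain logic `L^{c,*}_{μ,ν}`: sentences are the formulas of `L_{μ,ν}` without free
variables, models are all weak chain models of `τ`, and satisfaction is `⊨^c`. -/
def weakChainLogic (τ : Vocabulary.{u}) (μ ν : Cardinal.{u}) : Logic.{u} where
  Sentence := Formula τ μ ν PEmpty.{u + 1}
  Mod := WeakChainModel τ
  Sat C φ := φ.Holds C PEmpty.elim

/-- `𝒞(K)`: all weak chain representations of models in `K`. -/
def chainRepresentations {τ : Vocabulary.{u}} (K : Set (Model τ)) : Set (WeakChainModel τ) :=
  {C | C.model ∈ K}

end ChainLogic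

/-! Density is clear, since every model is the union of a constant chain; the content is that `𝒞(K)`
is definable in chain logic. A chain cuts any set into countably many bounded pieces according to
`level`. In the borrowing game Player II takes `level` as her function `h`, so that each debt
falling due is a small bounded set, exactly what a chain quantifier can reach. Hence equivalence of
rank `2 * β` in the back-and-forth system of bounded `Θ`-tuples implies `∼_{β,θ}` for the underlying
models (`BackForth.borrowingSim`). By a beth computation, fewer than `κ` formulas decide this
equivalence, because `κ = ℶ_κ` (`exists_determining_family`). So `K` is defined by the disjunction
of the types over these formulas that are realized in `K`. -/

open Cardinal Ordinal

namespace ChainLogic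

variable {τ : Vocabulary.{u}}

/-! ### Partial injections given by pairs of tuples -/

section Tuples

variable {X A B : Type u}

open Classical in
/-- The partial injection `a i ↦ b i` given by two tuples with the same equalities. -/
noncomputable def tuplePEquiv (a : X → A) (b : X → B) (h : ∀ i j, a i = a j ↔ b i = b j) :
    A ≃. B where
  toFun x := if hx : ∃ i, a i = x then some (b hx.choose) else none
  invFun y := if hy : ∃ i, b i = y then some (a hy.choose) else none
  inv x y := by
    by_cases hx : ∃ i, a i = x <;> by_cases hy : ∃ i, b i = y
    · simp only [hx, hy, dif_pos, Option.some.injEq]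
      constructor
      · intro e
        rw [← hy.choose_spec, ← h, hx.choose_spec, e]
      · intro e
        rw [← hx.choose_spec, h, hy.choose_spec, e]
    · simp only [hx, hy, dif_pos, Option.some.injEq]
      exact iff_of_false (by simp) fun e => hy ⟨_, e⟩
    · simp only [hx, hy, dif_pos, Option.some.injEq]
      exact iff_of_false (fun e => hx ⟨_, e⟩) (by simp)
    · simp [hx, hy]

theorem mem_tuplePEquiv (a : X → A) (b : X → B) (h : ∀ i j, a i = a j ↔ b i = b j)
    (x : A) (y : B) : y ∈ tuplePEquiv a b h x ↔ ∃ i, a i = x ∧ b i = y := by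
  classical
  change y ∈ (if hx : ∃ i, a i = x then some (b hx.choose) else none) ↔ _
  by_cases hx : ∃ i, a i = x
  · rw [dif_pos hx, Option.mem_def, Option.some.injEq]
    constructor
    · exact fun e => ⟨_, hx.choose_spec, e⟩
    · rintro ⟨i, hi, rfl⟩
      rw [← h, hx.choose_spec, hi]
  · rw [dif_neg hx]
    simp only [Option.mem_def, reduceCtorEq, false_iff]
    rintro ⟨i, hi, -⟩
    exact hx ⟨i, hi⟩

end Tuples

/-! ### Bounded sets and levels in chain models -/

namespace WeakChainModel

/-- A set is bounded if it is contained in a member of the chain. -/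
def Bounded (C : WeakChainModel τ) (S : Set C.model) : Prop :=
  ∃ n, S ⊆ C.chain n

theorem monotone_chain (C : WeakChainModel τ) : Monotone C.chain :=
  monotone_nat_of_le_succ C.chain_subset_succ

theorem exists_mem_chain (C : WeakChainModel τ) (x : C.model) : ∃ n, x ∈ C.chain n := by
  have : x ∈ ⋃ n, C.chain n := by rw [C.iUnion_chain]; trivial
  simpa using this

open Classical in
/-- The first member of the chain containing `x`. -/
noncomputable def level (C : WeakChainModel τ) (x : C.model) : ℕ :=
  Nat.find (C.exists_mem_chain x)

theorem mem_chain_level (C : WeakChainModel τ) (x : C.model) : x ∈ C.chain (C.level x) := by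
  classical
  exact Nat.find_spec (C.exists_mem_chain x)

theorem Bounded.union {C : WeakChainModel τ} {S T : Set C.model} (hS : C.Bounded S)
    (hT : C.Bounded T) : C.Bounded (S ∪ T) := by
  obtain ⟨m, hm⟩ := hS
  obtain ⟨n, hn⟩ := hT
  exact ⟨max m n, Set.union_subset (hm.trans (C.monotone_chain (le_max_left _ _)))
    (hn.trans (C.monotone_chain (le_max_right _ _)))⟩

theorem bounded_empty (C : WeakChainModel τ) : C.Bounded ∅ :=
  ⟨0, Set.empty_subset _⟩

theorem bounded_level_eq (C : WeakChainModel τ) (X : Set C.model) (k : ℕ) :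
    C.Bounded {x ∈ X | C.level x = k} := by
  refine ⟨k, ?_⟩
  rintro x ⟨-, rfl⟩
  exact C.mem_chain_level x

/-- A bounded set of size at most `#Θ` is covered by a bounded tuple of length `Θ`. -/
theorem Bounded.exists_tuple {C : WeakChainModel τ} {S : Set C.model} (hS : C.Bounded S)
    {Θ : Type u} (hΘ : #S ≤ #Θ) :
    ∃ c : Θ → C.model, C.Bounded (Set.range c) ∧ S ⊆ Set.range c := by
  classical
  -- The element `x` pads the tuple at indices outside the range of `e`; adding it keeps the set
  -- bounded.
  obtain ⟨x⟩ := C.model.nonempty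
  obtain ⟨e⟩ := hΘ
  have hx : C.Bounded {x} := ⟨C.level x, Set.singleton_subset_iff.2 (C.mem_chain_level x)⟩
  obtain ⟨n, hn⟩ := hS.union hx
  refine ⟨fun t => if h : ∃ s, e s = t then h.choose.1 else x, ⟨n, ?_⟩, ?_⟩
  · rintro _ ⟨t, rfl⟩
    apply hn
    by_cases h : ∃ s, e s = t
    · simp only [dif_pos h]
      exact Or.inl h.choose.2
    · simp only [dif_neg h]
      exact Or.inr rfl
  · intro s hs
    have h : ∃ s', e s' = e ⟨s, hs⟩ := ⟨_, rfl⟩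
    refine ⟨e ⟨s, hs⟩, ?_⟩
    simp only [dif_pos h]
    exact congrArg Subtype.val (e.injective h.choose_spec)

end WeakChainModel

/-! ### The back-and-forth system of bounded tuples -/

open WeakChainModel

/-- Back-and-forth equivalence of rank `α` between tuples in chain models. In every round a
bounded tuple of length `Θ` in one model is answered by such a tuple in the other one. -/
def BackForth (Θ : Type u) (α : Ordinal.{u}) (C D : WeakChainModel τ) {X : Type u}
    (a : X → C.model) (b : X → D.model) : Prop :=
  (∀ i j, a i = a j ↔ b i = b j) ∧
  (∀ (R : τ.Rel) (x : τ.Arity R → X),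
    C.model.rel R (fun i => a (x i)) ↔ D.model.rel R (fun i => b (x i))) ∧
  ∀ γ < α,
    (∀ c : Θ → C.model, C.Bounded (Set.range c) → ∃ d : Θ → D.model, D.Bounded (Set.range d) ∧
      BackForth Θ γ C D (Sum.elim a c) (Sum.elim b d)) ∧
    (∀ d : Θ → D.model, D.Bounded (Set.range d) → ∃ c : Θ → C.model, C.Bounded (Set.range c) ∧
      BackForth Θ γ C D (Sum.elim a c) (Sum.elim b d))
termination_by α

namespace BackForth

variable {Θ X : Type u} {α : Ordinal.{u}} {C D : WeakChainModel τ}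
  {a : X → C.model} {b : X → D.model}

theorem eq_iff (h : BackForth Θ α C D a b) : ∀ i j, a i = a j ↔ b i = b j := by
  rw [BackForth] at h
  exact h.1

theorem rel_iff (h : BackForth Θ α C D a b) (R : τ.Rel) (x : τ.Arity R → X) :
    C.model.rel R (fun i => a (x i)) ↔ D.model.rel R (fun i => b (x i)) := by
  rw [BackForth] at h
  exact h.2.1 R x

theorem forth (h : BackForth Θ α C D a b) {γ : Ordinal.{u}} (hγ : γ < α) (c : Θ → C.model)
    (hc : C.Bounded (Set.range c)) : ∃ d : Θ → D.model, D.Bounded (Set.range d) ∧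
      BackForth Θ γ C D (Sum.elim a c) (Sum.elim b d) := by
  rw [BackForth] at h
  exact (h.2.2 γ hγ).1 c hc

theorem back (h : BackForth Θ α C D a b) {γ : Ordinal.{u}} (hγ : γ < α) (d : Θ → D.model)
    (hd : D.Bounded (Set.range d)) : ∃ c : Θ → C.model, C.Bounded (Set.range c) ∧
      BackForth Θ γ C D (Sum.elim a c) (Sum.elim b d) := by
  rw [BackForth] at h
  exact (h.2.2 γ hγ).2 d hd

theorem symm (h : BackForth Θ α C D a b) : BackForth Θ α D C b a := by
  induction α using WellFoundedLT.induction generalizing X with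
  | ind α ih =>
    rw [BackForth]
    refine ⟨fun i j => (h.eq_iff i j).symm, fun R x => (h.rel_iff R x).symm, fun γ hγ => ⟨?_, ?_⟩⟩
    · intro d hd
      obtain ⟨c, hc, h'⟩ := h.back hγ d hd
      exact ⟨c, hc, ih γ hγ h'⟩
    · intro c hc
      obtain ⟨d, hd, h'⟩ := h.forth hγ c hc
      exact ⟨d, hd, ih γ hγ h'⟩

end BackForth

/-! ### From back-and-forth equivalence to the borrowing game -/

/-- `g` is the partial injection between two tuples which are back-and-forth equivalent. -/
def BackForthMap (Θ : Type u) (α : Ordinal.{u}) (C D : WeakChainModel τ)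
    (g : C.model ≃. D.model) : Prop :=
  ∃ (X : Type u) (a : X → C.model) (b : X → D.model), BackForth Θ α C D a b ∧
    ∀ x y, y ∈ g x ↔ ∃ i, a i = x ∧ b i = y

namespace BackForthMap

variable {Θ : Type u} {α β γ : Ordinal.{u}} {C D : WeakChainModel τ} {g : C.model ≃. D.model}

theorem symm (hg : BackForthMap Θ α C D g) : BackForthMap Θ α D C g.symm := by
  obtain ⟨X, a, b, h, hg⟩ := hg
  refine ⟨X, b, a, h.symm, fun x y => ?_⟩
  rw [PEquiv.mem_iff_mem, hg]
  simp only [and_comm]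

theorem isPartialIso (hg : BackForthMap Θ α C D g) : IsPartialIso g := by
  obtain ⟨X, a, b, h, hg⟩ := hg
  intro R x y hxy
  choose f hfa hfb using fun i => (hg (x i) (y i)).1 (hxy i)
  have := h.rel_iff R f
  simpa only [hfa, hfb] using this

/-- Two rounds of the back-and-forth system bring a small bounded set into the domain and another
one into the range. -/
theorem exists_extension (hg : BackForthMap Θ (2 * β) C D g) (hγ : γ < β)
    {S : Set C.model} (hS : C.Bounded S) (hSΘ : #S ≤ #Θ)
    {T : Set D.model} (hT : D.Bounded T) (hTΘ : #T ≤ #Θ) :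
    ∃ g' : C.model ≃. D.model, g ≤ g' ∧ S ⊆ domain g' ∧ T ⊆ domain g'.symm ∧
      BackForthMap Θ (2 * γ) C D g' := by
  obtain ⟨X, a, b, h, hg⟩ := hg
  -- One game round costs two ranks: `2 * γ + 1` is left after the forth step covering `S`, and `2 *
  -- γ` after the back step covering `T`.
  have h₂ : 2 * γ + 1 < 2 * β := by
    have h₀ : 2 * (γ + 1) ≤ 2 * β := mul_le_mul_right (Order.add_one_le_of_lt hγ) 2
    rw [mul_add, mul_one] at h₀
    have : (2 : Ordinal.{u}) = 1 + 1 := one_add_one_eq_two.symm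
    refine lt_of_lt_of_le ?_ h₀
    exact add_lt_add_right (by norm_num) _
  obtain ⟨c, hc, hSc⟩ := hS.exists_tuple hSΘ
  obtain ⟨d', hd', hTd⟩ := hT.exists_tuple hTΘ
  obtain ⟨d, -, h⟩ := h.forth h₂ c hc
  obtain ⟨c', -, h⟩ := h.back (lt_add_one (2 * γ)) d' hd'
  refine ⟨tuplePEquiv _ _ h.eq_iff, ?_, ?_, ?_, _, _, _, h, mem_tuplePEquiv _ _ _⟩
  · rw [PEquiv.le_def]
    intro x y hxy
    obtain ⟨i, hi⟩ := (hg x y).1 hxy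
    exact (mem_tuplePEquiv _ _ _ _ _).2 ⟨.inl (.inl i), hi⟩
  · intro x hx
    obtain ⟨i, hi⟩ := hSc hx
    exact ⟨d i, (mem_tuplePEquiv _ _ _ _ _).2 ⟨.inl (.inr i), hi, rfl⟩⟩
  · intro y hy
    obtain ⟨i, hi⟩ := hTd hy
    refine ⟨c' i, ?_⟩
    rw [PEquiv.mem_iff_mem, mem_tuplePEquiv]
    exact ⟨.inr i, rfl, hi⟩

/-- Player II wins the borrowing game by borrowing each element for as many rounds as its level
in the chain indicates. -/
theorem playerTwoWins {θ₀ : Cardinal.{u}} (hθ₀ : θ₀ ≤ #Θ) (hΘ : ℵ₀ ≤ #Θ)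
    {P : ℕ → Set C.model} {Q : ℕ → Set D.model}
    (hP : ∀ k, C.Bounded (P k)) (hPΘ : ∀ k, #(P k) ≤ #Θ)
    (hQ : ∀ k, D.Bounded (Q k)) (hQΘ : ∀ k, #(Q k) ≤ #Θ)
    (hg : BackForthMap Θ (2 * β) C D g) :
    PlayerTwoWins θ₀ C.model D.model β P Q g := by
  induction β using WellFoundedLT.induction generalizing C D with
  | ind β ih =>
    -- The invariant: a debt stays bounded and of size at most `#Θ` when one level of a new move is
    -- added.
    have hunion : ∀ (k : ℕ) (X : Set C.model), #X ≤ θ₀ → ∀ l,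
        C.Bounded (P k ∪ {x ∈ X | C.level x = l}) ∧
        #(P k ∪ {x ∈ X | C.level x = l} : Set C.model) ≤ #Θ := fun k X hX l =>
      ⟨(hP k).union (C.bounded_level_eq X l), (mk_union_le _ _).trans
        (add_le_of_le hΘ (hPΘ k) (((mk_le_mk_of_subset (Set.sep_subset _ _)).trans hX).trans hθ₀))⟩
    have key : ∀ (γ : Ordinal.{u}) (X : Set C.model), ∃ g' : C.model ≃. D.model,
        γ < β → #X ≤ θ₀ → g ≤ g' ∧ P 0 ∪ {x ∈ X | C.level x = 0} ⊆ domain g' ∧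
          Q 0 ⊆ domain g'.symm ∧ BackForthMap Θ (2 * γ) C D g' := by
      intro γ X
      by_cases h : γ < β ∧ #X ≤ θ₀
      · obtain ⟨g', hg'⟩ := hg.exists_extension h.1 (hunion 0 X h.2 0).1 (hunion 0 X h.2 0).2
          (hQ 0) (hQΘ 0)
        exact ⟨g', fun _ _ => hg'⟩
      -- The answer to an illegal move is arbitrary.
      · exact ⟨⊥, fun h₁ h₂ => (h ⟨h₁, h₂⟩).elim⟩
    choose g' hg' using key
    refine .intro (fun _ _ => C.level) g' ?_ ?_ ?_ ?_ ?_ ?_ <;> intro γ hγ X hX <;>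
      obtain ⟨hle, hdom, hran, hmap⟩ := hg' γ X hγ hX
    · exact hle
    · exact hmap.isPartialIso
    · exact Set.subset_union_right.trans hdom
    · exact Set.subset_union_left.trans hdom
    · exact hran
    · exact ih γ hγ (fun k => hQ (k + 1)) (fun k => hQΘ (k + 1))
        (fun k => (hunion (k + 1) X hX (k + 1)).1) (fun k => (hunion (k + 1) X hX (k + 1)).2)
        hmap.symm

end BackForthMap

/-- The game starts without debts, and its empty map is the one given by the empty tuples. -/
theorem BackForth.borrowingSim {Θ : Type u} {β : Ordinal.{u}} {θ : Cardinal.{u}} (hθ : θ ≤ #Θ)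
    (hΘ : ℵ₀ ≤ #Θ) {C D : WeakChainModel τ}
    (h : BackForth Θ (2 * β) C D (PEmpty.elim : PEmpty.{u + 1} → C.model) PEmpty.elim) :
    BorrowingSim β θ C.model D.model := by
  intro θ₀ hθ₀
  refine BackForthMap.playerTwoWins (hθ₀.trans hθ) hΘ (fun _ => C.bounded_empty) (by simp)
    (fun _ => D.bounded_empty) (by simp) ⟨_, _, _, h, fun x y => ?_⟩
  simp

/-! ### Counting the formulas that decide back-and-forth equivalence -/

section Definability

variable {κ : Cardinal.{u}} {X : Type u}

open Classical in
/-- The formula saying that exactly the members of `s` hold among a family of formulas. -/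
noncomputable def Formula.ofType {ν : Cardinal.{u}} {I : Type u} (hI : #I < κ)
    (ψ : I → Formula τ κ ν X) (s : Set I) : Formula τ κ ν X :=
  .conj I hI fun i => if i ∈ s then ψ i else .neg (ψ i)

theorem Formula.holds_ofType {ν : Cardinal.{u}} {I : Type u} (hI : #I < κ)
    (ψ : I → Formula τ κ ν X) (s : Set I) (C : WeakChainModel τ) (v : X → C.model) :
    (Formula.ofType hI ψ s).Holds C v ↔ ∀ i, i ∈ s ↔ (ψ i).Holds C v := by
  rw [Formula.ofType, Formula.Holds]
  refine forall_congr' fun i => ?_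
  by_cases hi : i ∈ s <;> simp [hi, Formula.Holds]

theorem Formula.holds_ex {μ ν : Cardinal.{u}} {Y : Type u} (hY : #Y < ν)
    (φ : Formula τ μ ν (X ⊕ Y)) (C : WeakChainModel τ) (v : X → C.model) :
    (Formula.ex Y hY φ).Holds C v ↔
      ∃ c : Y → C.model, C.Bounded (Set.range c) ∧ φ.Holds C (Sum.elim v c) := by
  rw [Formula.Holds]
  simp only [Bounded, Set.range_subset_iff]
  constructor
  · rintro ⟨n, c, hc, h⟩
    exact ⟨c, ⟨n, hc⟩, h⟩
  · rintro ⟨c, ⟨n, hc⟩, h⟩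
    exact ⟨n, c, hc, h⟩

variable (τ) in
/-- Indices for the atomic formulas with variables in `X`. -/
abbrev Atoms (X : Type u) : Type u :=
  (X × X) ⊕ (Σ R : τ.Rel, τ.Arity R → X)

/-- Each relation symbol contributes at most `lam ^ lam = 2 ^ lam` atoms, and there are only
countably many symbols. -/
theorem mk_atoms_le [Countable τ.Rel] {lam : Cardinal.{u}} (hlam : ℵ₀ ≤ lam) (hX : #X ≤ lam)
    (har : ∀ R : τ.Rel, #(τ.Arity R) ≤ lam) : #(Atoms τ X) ≤ 2 ^ lam := by
  have h2 : ℵ₀ ≤ (2 : Cardinal.{u}) ^ lam := hlam.trans (cantor lam).le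
  have hX2 : #X ≤ 2 ^ lam := hX.trans (cantor lam).le
  rw [mk_sum, Cardinal.lift_id, Cardinal.lift_id, ← mul_def, mk_sigma]
  refine add_le_of_le h2 (mul_le_of_le h2 hX2 hX2) ((Cardinal.sum_le_sum _ (fun _ => 2 ^ lam)
    fun R => ?_).trans ?_)
  · rw [mk_arrow, Cardinal.lift_id, Cardinal.lift_id, ← power_self_eq hlam]
    exact (power_le_power_right hX).trans
      (power_le_power_left (aleph0_pos.trans_le hlam).ne' (har R))
  · rw [sum_const, Cardinal.lift_id, Cardinal.lift_id]
    exact mul_le_of_le h2 ((mk_le_aleph0_iff.2 inferInstance).trans h2) le_rfl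

/-- The back-and-forth equivalence of rank `α` is determined by `ℶ_(δ + α)` formulas. -/
theorem exists_determining_family (hbeth : ℶ_ κ.ord = κ) {Θ : Type u} (hΘ : ℵ₀ ≤ #Θ)
    (hΘκ : #Θ < κ) {δ : Ordinal.{u}}
    (hatoms : ∀ X : Type u, #X ≤ #Θ → #(Atoms τ X) ≤ ℶ_ δ) (α : Ordinal.{u})
    (hαδ : α.card ≤ ℶ_ δ) (hα : δ + α < κ.ord) (hX : #X ≤ #Θ) :
    ∃ (I : Type u) (ψ : I → Formula τ κ κ X), #I ≤ ℶ_ (δ + α) ∧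
      ∀ (C D : WeakChainModel τ) (a : X → C.model) (b : X → D.model),
        (∀ i, (ψ i).Holds C a ↔ (ψ i).Holds D b) → BackForth Θ α C D a b := by
  induction α using WellFoundedLT.induction generalizing X with
  | ind α ih =>
    have hXΘ : #(X ⊕ Θ) ≤ #Θ := by
      rw [mk_sum, Cardinal.lift_id, Cardinal.lift_id]
      exact add_le_of_le hΘ hX le_rfl
    have hlt : ∀ γ : α.ToType, (γ.toOrd : Ordinal.{u}) < α := fun γ => γ.toOrd.2
    have hκ : ∀ γ : α.ToType, δ + (γ.toOrd : Ordinal.{u}) < κ.ord := fun γ =>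
      (add_le_add_right (hlt γ).le δ).trans_lt hα
    choose J χ hJ hχ using fun γ : α.ToType =>
      ih γ.toOrd (hlt γ) ((card_le_card (hlt γ).le).trans hαδ) (hκ γ) hXΘ
    have hJκ : ∀ γ, #(J γ) < κ := fun γ => by
      refine (hJ γ).trans_lt ?_
      conv_rhs => rw [← hbeth]
      exact beth_lt_beth.2 (hκ γ)
    -- Besides the atoms, the family says for each `γ < α` and each set `s` of formulas of rank `γ`
    -- whether some bounded `Θ`-tuple realizes exactly `s`.
    refine ⟨Atoms τ X ⊕ (Σ γ : α.ToType, Set (J γ)),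
      Sum.elim (Sum.elim (fun p => .equal p.1 p.2) (fun p => .rel p.1 p.2))
        (fun p => .ex Θ hΘκ (.ofType (hJκ p.1) (χ p.1) p.2)), ?_, ?_⟩
    · have hδα : ℶ_ δ ≤ ℶ_ (δ + α) := beth_le_beth.2 (le_add_of_nonneg_right zero_le)
      rw [mk_sum, Cardinal.lift_id, Cardinal.lift_id, mk_sigma]
      refine add_le_of_le (aleph0_le_beth _) ((hatoms X hX).trans hδα)
        ((Cardinal.sum_le_sum _ (fun _ => ℶ_ (δ + α)) fun γ => ?_).trans ?_)
      -- Passing to sets of formulas costs one power set: `2 ^ ℶ_(δ + γ) = ℶ_(δ + γ + 1)`, which is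
      -- at most `ℶ_(δ + α)`.
      · rw [mk_set]
        refine (power_le_power_left two_ne_zero (hJ γ)).trans ?_
        rw [← beth_add_one, add_assoc]
        exact beth_le_beth.2 (add_le_add_right (Order.add_one_le_of_lt (hlt γ)) δ)
      · rw [sum_const, Cardinal.lift_id, Cardinal.lift_id, mk_toType]
        exact mul_le_of_le (aleph0_le_beth _) (hαδ.trans hδα) le_rfl
    · intro C D a b h
      rw [BackForth]
      refine ⟨fun i j => ?_, fun R x => ?_, fun γ hγ => ?_⟩
      · simpa only [Sum.elim_inl, Formula.Holds] using h (.inl (.inl (i, j)))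
      · simpa only [Sum.elim_inl, Sum.elim_inr, Formula.Holds] using h (.inl (.inr ⟨R, x⟩))
      · obtain ⟨γ, rfl⟩ : ∃ γ' : α.ToType, (γ'.toOrd : Ordinal.{u}) = γ :=
          ⟨ToType.mk ⟨γ, hγ⟩, by simp [ToType.toOrd]⟩
        have hs : ∀ s : Set (J γ),
            (∃ c : Θ → C.model, C.Bounded (Set.range c) ∧
              ∀ i, i ∈ s ↔ (χ γ i).Holds C (Sum.elim a c)) ↔
            (∃ d : Θ → D.model, D.Bounded (Set.range d) ∧
              ∀ i, i ∈ s ↔ (χ γ i).Holds D (Sum.elim b d)) := fun s => by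
          simpa only [Sum.elim_inr, Formula.holds_ex, Formula.holds_ofType] using
            h (.inr ⟨γ, s⟩)
        constructor
        · intro c hc
          -- The answer to `c` is a bounded tuple realizing the same type of rank `γ`.
          obtain ⟨d, hd, h'⟩ := (hs {i | (χ γ i).Holds C (Sum.elim a c)}).1
            ⟨c, hc, fun i => Iff.rfl⟩
          exact ⟨d, hd, hχ γ C D _ _ h'⟩
        · intro d hd
          obtain ⟨c, hc, h'⟩ := (hs {i | (χ γ i).Holds D (Sum.elim b d)}).2
            ⟨d, hd, fun i => Iff.rfl⟩
          exact ⟨c, hc, hχ γ C D _ _ fun i => (h' i).symm⟩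

end Definability

/-! ### Defining Shelah sentences in chain logic -/

theorem IsShelahSentence.exists_sim_closed {κ : Cardinal.{u}} {K : Set (Model τ)}
    (hK : IsShelahSentence κ K) : ∃ θ < κ, ∃ β < (Order.succ θ).ord,
      ∀ M N : Model τ, BorrowingSim β θ M N → M ∈ K → N ∈ K := by
  obtain ⟨θ, hθ, β, hβ, E, hE, rfl⟩ := hK
  refine ⟨θ, hθ, β, hβ, ?_⟩
  rintro M N hMN ⟨S, hS, hM⟩
  obtain ⟨N₀, rfl⟩ := hE hS
  exact ⟨_, hS, (borrowingSetoid τ β θ).trans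
    ((borrowingSetoid τ β θ).symm (Relation.EqvGen.rel _ _ hMN)) hM⟩

/-- The weak chain representations of a sentence of Shelah's logic are definable in chain logic. -/
theorem exists_formula_holds_iff {κ : Cardinal.{u}} (hbeth : ℶ_ κ.ord = κ) [Countable τ.Rel]
    (harity : ∃ ρ < κ, ∀ R : τ.Rel, #(τ.Arity R) ≤ ρ) {K : Set (Model τ)}
    (hK : IsShelahSentence κ K) :
    ∃ φ : Formula τ κ κ PEmpty.{u + 1}, ∀ C : WeakChainModel τ,
      φ.Holds C PEmpty.elim ↔ C.model ∈ K := by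
  have hκ₀ : 0 < κ.ord := by
    rw [← not_le, nonpos_iff_eq_zero, ord_eq_zero]
    rintro rfl
    exact beth_ne_zero _ hbeth
  have hω : ℵ₀ < κ := by
    rw [← hbeth, ← beth_zero]
    exact beth_lt_beth.2 hκ₀
  -- A beth fixed point is a strong limit, since `c ≤ ℶ_c`.
  have hpow : ∀ c < κ, 2 ^ c < κ := fun c hc => by
    have hlt : c.ord + 1 < κ.ord := (isSuccLimit_ord hω.le).add_one_lt (ord_lt_ord.2 hc)
    calc 2 ^ c ≤ 2 ^ ℶ_ c.ord := power_le_power_left two_ne_zero (le_beth_ord c)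
      _ = ℶ_ (c.ord + 1) := (beth_add_one _).symm
      _ < ℶ_ κ.ord := beth_lt_beth.2 hlt
      _ = κ := hbeth
  obtain ⟨θ, hθ, β, hβ, hclosed⟩ := hK.exists_sim_closed
  obtain ⟨ρ, hρ, har⟩ := harity
  let Θ : Type u := (max θ ℵ₀).out
  have hΘ : #Θ = max θ ℵ₀ := mk_out _
  have hΘ₀ : ℵ₀ ≤ #Θ := hΘ ▸ le_max_right _ _
  have hΘκ : #Θ < κ := hΘ ▸ max_lt hθ hω
  let lam : Cardinal.{u} := max (#Θ) ρ
  have hβκ : 2 * β < κ.ord := by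
    refine isPrincipal_mul_ord hω.le ?_ ?_
    · rw [lt_ord]
      simpa using hω.trans_le' ((natCast_lt_aleph0 (n := 2)).le.trans' (by simp))
    · rw [lt_ord]
      exact (Order.lt_succ_iff.1 (lt_ord.1 hβ)).trans_lt hθ
  -- `μ` bounds both the number of atoms and the number of ranks. As `μ ≤ ℶ_μ`, the count can start
  -- at `δ = μ.ord`, and `δ + 2 * β` stays below `κ.ord` by additive closure.
  let μ : Cardinal.{u} := max (2 ^ lam) (2 * β).card
  have hμ : μ < κ := max_lt (hpow _ (max_lt hΘκ hρ)) (lt_ord.1 hβκ)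
  obtain ⟨I, ψ, hI, hψ⟩ := exists_determining_family (τ := τ) (X := PEmpty.{u + 1}) hbeth hΘ₀ hΘκ
    (δ := μ.ord)
    (fun X hX => (mk_atoms_le (hΘ₀.trans (le_max_left _ ρ)) (hX.trans (le_max_left _ ρ))
      fun R => (har R).trans (le_max_right _ _)).trans ((le_max_left _ _).trans (le_beth_ord μ)))
    (2 * β) ((le_max_right _ _).trans (le_beth_ord μ))
    (isPrincipal_add_ord hω.le (ord_lt_ord.2 hμ) hβκ) (by simp)
  have hIκ : #I < κ := by
    refine hI.trans_lt ?_
    conv_rhs => rw [← hbeth]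
    exact beth_lt_beth.2 (isPrincipal_add_ord hω.le (ord_lt_ord.2 hμ) hβκ)
  let types : Set (Set I) :=
    {s | ∃ C : WeakChainModel τ, C.model ∈ K ∧ ∀ i, i ∈ s ↔ (ψ i).Holds C PEmpty.elim}
  have htypes : #types < κ := (mk_set_le types).trans_lt (by rw [mk_set]; exact hpow _ hIκ)
  refine ⟨.disj types htypes fun s => .ofType hIκ ψ s, fun D => ?_⟩
  rw [Formula.Holds]
  simp only [Formula.holds_ofType]
  constructor
  -- `D` shares its type with some `C` whose model is in `K`, so the two models are
  -- `∼_{β,θ}`-related and membership in `K` transfers.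
  · rintro ⟨⟨s, C, hC, hs⟩, hD⟩
    exact hclosed _ _ ((hψ C D PEmpty.elim PEmpty.elim fun i =>
      (hs i).symm.trans (hD i)).borrowingSim (hΘ ▸ le_max_left _ _) hΘ₀) hC
  · exact fun hD => ⟨⟨{i | (ψ i).Holds D PEmpty.elim}, D, hD, fun i => Iff.rfl⟩, fun i => Iff.rfl⟩

/-- The chain model of a model in which every member of the chain is the whole universe. -/
def WeakChainModel.const (M : Model τ) : WeakChainModel τ where
  model := M
  chain _ := Set.univ
  chain_subset_succ _ := subset_rfl
  iUnion_chain := Set.iUnion_const _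

end ChainLogic

theorem theorem4p6 (κ : Cardinal.{u})
    (hbeth : Cardinal.beth κ.ord = κ)
    (hsing : κ.IsSingular) (hcof : κ.ord.cof = Cardinal.aleph0)
    (τ : ChainLogic.Vocabulary.{u}) (hτ : Countable τ.Rel)
    (harity : ∃ ρ < κ, ∀ R : τ.Rel, Cardinal.mk (τ.Arity R) ≤ ρ) :
    (ChainLogic.shelahLogic τ κ).ChuLE (ChainLogic.weakChainLogic τ κ κ) ∧
    ∃ T : ChainLogic.ChuTransform (ChainLogic.shelahLogic τ κ)
        (ChainLogic.weakChainLogic τ κ κ),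
      T.IsDense ∧
      (∀ C : ChainLogic.WeakChainModel τ, T.onModels C = C.model) ∧
      (∀ K : (ChainLogic.shelahLogic τ κ).Sentence,
        {C : ChainLogic.WeakChainModel τ |
            (ChainLogic.weakChainLogic τ κ κ).Sat C (T.onSentences K)} =
          ChainLogic.chainRepresentations K.1) := by
  have key : ∀ K : (ChainLogic.shelahLogic τ κ).Sentence, ∃ φ : ChainLogic.Formula τ κ κ PEmpty,
      ∀ C : ChainLogic.WeakChainModel τ, φ.Holds C PEmpty.elim ↔ C.model ∈ K.1 := fun K =>
    ChainLogic.exists_formula_holds_iff hbeth harity K.2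
  choose f hf using key
  let T : ChainLogic.ChuTransform (ChainLogic.shelahLogic τ κ)
      (ChainLogic.weakChainLogic τ κ κ) := ⟨f, fun C => C.model, fun C K => hf K C⟩
  have hT : T.IsDense := fun K ⟨M, hM⟩ => ⟨ChainLogic.WeakChainModel.const M, hM⟩
  exact ⟨⟨T, hT⟩, T, hT, fun C => rfl, fun K => Set.ext fun C => hf K C⟩
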